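/- Let $c\ge 1$ be a real number and let $V$ be a complex inner product space (not necessarily complete) carrying a unitary representation $\{L_n\}_{n\in\mathbb Z}$ of the Virasoro algebra with central charge $c$, i.e. linear operators on $V$ with $$[L_n,L_m]=(n-m)L_{n+m}+\frac{c}{12}(n^3-n)\,\delta_{n,-m}\mathbb 1,\qquad \langle\Psi,L_n\Phi\rangle=\langle L_{-n}\Psi,\Phi\rangle$$ for all $n,m\in\mathbb Z$ and $\Psi,\Phi\in V$. Suppose that $V$ is an (algebraic) direct sum of irreducible lowest weight subrepresentations $W_i$, $i\in I$, with lowest weights $h_i\ge 0$; that is, each $W_i$ is irreducible and contains a nonzero cyclic vector $\Omega_i$ with $L_0\Omega_i=h_i\Omega_i$ and $L_n\Omega_i=0$ for all $n>0$. Let $$:L^2:_0\;=\;\sum_{k>-2}L_{-k}L_k+\sum_{k\le -2}L_kL_{-k}$$ be the zero mode of the normal-ordered square of $L(z)=\sum_n L_nz^{-n-2}$. Then, for every $\Psi\in V$, only finitely many terms of these sums are nonzero on $\Psi$, and $$0\le\langle\Psi,\,:L^2:_0\Psi\rangle\le\langle\Psi,\,11(c+1)(\mathbb 1+L_0^3)\Psi\rangle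 .$$ -/

import Mathlib

open scoped ComplexOrder

namespace Virasoro

section

variable {V : Type*}

/-- The operators `L n` represent the Virasoro algebra on `V`, the central element acting as the
scalar `c`. -/
def IsRep [AddCommGroup V] [Module ℂ V] (c : ℝ) (L : ℤ → Module.End ℂ V) : Prop :=
  ∀ n m : ℤ, L n * L m - L m * L n =
    ((n : ℂ) - (m : ℂ)) • L (n + m) +
      (if n = -m then (c : ℂ) / 12 * ((n : ℂ) ^ 3 - (n : ℂ)) else 0) • (1 : Module.End ℂ V)

/-- The inner product of `V` is invariant: `L (-n)` is the formal adjoint of `L n`. -/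
def IsUnitary [NormedAddCommGroup V] [InnerProductSpace ℂ V] (L : ℤ → Module.End ℂ V) : Prop :=
  ∀ (n : ℤ) (Φ Ψ : V), inner ℂ Ψ (L n Φ) = inner ℂ (L (-n) Ψ) Φ

/-- `W` is a subrepresentation. -/
def IsInvariant [AddCommGroup V] [Module ℂ V] (L : ℤ → Module.End ℂ V)
    (W : Submodule ℂ V) : Prop :=
  ∀ (n : ℤ), ∀ v ∈ W, L n v ∈ W

/-- `W` is an irreducible subrepresentation. -/
structure IsIrreducible [AddCommGroup V] [Module ℂ V] (L : ℤ → Module.End ℂ V)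
    (W : Submodule ℂ V) : Prop where
  invariant : IsInvariant L W
  ne_bot : W ≠ ⊥
  eq_bot_or_eq : ∀ U : Submodule ℂ V, U ≤ W → IsInvariant L U → U = ⊥ ∨ U = W

/-- `W` is a lowest weight representation of lowest weight `h`: it has a nonzero cyclic vector `Ω`
with `L 0 Ω = h Ω` which is annihilated by all `L n` with `n > 0`. -/
structure IsLowestWeight [AddCommGroup V] [Module ℂ V] (L : ℤ → Module.End ℂ V)
    (W : Submodule ℂ V) (h : ℝ) : Prop where
  invariant : IsInvariant L W
  exists_cyclic : ∃ Ω ∈ W, Ω ≠ 0 ∧ L 0 Ω = (h : ℂ) • Ω ∧ (∀ n : ℤ, 0 < n → L n Ω = 0) ∧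
    ∀ U : Submodule ℂ V, IsInvariant L U → Ω ∈ U → W ≤ U

/-- The normally ordered product of `L (n - k)` and `L k`, the `k`-th term of the `n`-th mode of
the normal-ordered square. -/
def normalTerm [AddCommGroup V] [Module ℂ V] (L : ℤ → Module.End ℂ V) (n k : ℤ) :
    Module.End ℂ V :=
  if -2 < k then L (n - k) * L k else L k * L (n - k)

/-- The `n`-th mode of the normal-ordered square of the Virasoro field, applied to `Ψ`:
`∑_{k > -2} L_{n-k} L_k Ψ + ∑_{k ≤ -2} L_k L_{n-k} Ψ`, a sum with finitely many nonzero terms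
if `L m Ψ = 0` for all large `m`. -/
noncomputable def normalSquare [AddCommGroup V] [Module ℂ V] (L : ℤ → Module.End ℂ V) (n : ℤ)
    (Ψ : V) : V :=
  ∑ᶠ k : ℤ, normalTerm L n k Ψ

end

end Virasoro

/-!
# An energy bound for the zero mode of the normal-ordered square of the Virasoro field

Let `L 0 v = e v`, so that the expectation of the normal-ordered square in `v` is
`(e ^ 2 + 2 e) ‖v‖ ^ 2 + 2 ∑ ‖L k v‖ ^ 2`, the sum being over `k ≥ 1`. Everything rests on a bound of
order `e ^ 3` for this sum. Bounding each `‖L k v‖` separately gives only `c e ^ 4`. Instead, the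
weighted sums `S_K = ∑ k ‖L k v‖ ^ 2` over `1 ≤ k ≤ K` are bounded, for all `K` simultaneously, by
`K (c / 3 * K ^ 2 e + 14 / 3 * K e ^ 2) ‖v‖ ^ 2` (`weightedSum_le`), by induction on the energy, which
`L k` lowers by `k`.

For the induction put `X = ∑ k L (-k) L k v`. Then `S_K = ⟨v, X⟩`, and commuting `L k` past `L (-l)`
in `‖X‖ ^ 2 = ∑ k l ⟨L k v, L k L (-l) L l v⟩` yields three contributions (`norm_sq_sum_eq`):
* the exchange term `∑ k l ⟨L l L k v, L k L l v⟩`, at most `∑ k S_K (L k v)` by Cauchy-Schwarz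
  (`sum_exchange_le`), to which the induction hypothesis at energy `e - k` applies;
* a term linear in `L`, bounded by `sum_linear_le` with the help of the plain sums
  `∑ ‖L m (L l v)‖ ^ 2`, which Abel summation over `K` recovers from the weighted ones
  (`plainSum_le`);
* a diagonal central term of order `c k ^ 3`.

The bound decreases enough between the energies `e` and `e - k` to absorb the last two
(`weightedBound_step`), so `‖X‖ ^ 2` is at most the bound times `S_K`, and Cauchy-Schwarz for
`S_K = ⟨v, X⟩` closes the induction (`weightedSum_le_of_lower`). The weight `k` and the cut-off `K`
are what makes the linear term absorbable: without the weight its entries with `l` much smaller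
than `k` would cost a logarithm of the energy.

A lowest weight representation with `h ≥ 0` is spanned by vectors `L (-n₁) ⋯ L (-nᵣ) Ω`, hence by
eigenvectors of `L 0` with nonnegative eigenvalues; these are orthogonal for different eigenvalues,
and the normal-ordered square preserves the energy, so the bound on eigenvectors suffices
(`inner_nonneg_of_eigenvectors`).
-/

namespace Virasoro

open Finset

variable {V : Type*} [NormedAddCommGroup V] [InnerProductSpace ℂ V] {c : ℝ}
  {L : ℤ → Module.End ℂ V}

/-! ### Commutation relations and the Gram matrix -/

theorem IsRep.apply_apply (hL : IsRep c L) (n m : ℤ) (v : V) :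
    L n (L m v) = L m (L n v) + ((n : ℂ) - (m : ℂ)) • L (n + m) v +
      (if n = -m then (c : ℂ) / 12 * ((n : ℂ) ^ 3 - (n : ℂ)) else 0) • v := by
  have h := congrArg (fun T : Module.End ℂ V => T v) (hL n m)
  simp only [LinearMap.sub_apply, Module.End.mul_apply, LinearMap.add_apply,
    LinearMap.smul_apply, Module.End.one_apply] at h
  rw [add_assoc, ← h]
  abel

/-- `L k` lowers the energy by `k`. -/
theorem IsRep.map_zero_apply (hL : IsRep c L) {e : ℝ} {v : V} (hv : L 0 v = (e : ℂ) • v) (k : ℤ) :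
    L 0 (L k v) = ((e - k : ℝ) : ℂ) • L k v := by
  rw [hL.apply_apply 0 k, hv, map_smul]
  have : (if (0 : ℤ) = -k then (c : ℂ) / 12 * (((0 : ℤ) : ℂ) ^ 3 - ((0 : ℤ) : ℂ)) else 0) = 0 := by
    simp
  rw [this, zero_smul, add_zero, zero_add, ← add_smul]
  push_cast
  congr 1
  ring

theorem IsUnitary.inner_map_neg (hu : IsUnitary L) (k l : ℤ) (v w : V) :
    inner ℂ (L (-k) v) (L (-l) w) = inner ℂ v (L k (L (-l) w)) := (hu k _ _).symm

theorem inner_self_eq_ofReal (v : V) : inner ℂ v v = ((‖v‖ ^ 2 : ℝ) : ℂ) := by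
  rw [inner_self_eq_norm_sq_to_K]
  norm_cast

/-- Commuting `L k` past `L (-l)` splits the Gram matrix of the vectors `L (-k) v` into an exchange
term, a term with a single Virasoro operator, and the central term. -/
theorem re_inner_map_neg_map_neg (hL : IsRep c L) (hu : IsUnitary L) (k l : ℕ) (v w : V) :
    (inner ℂ (L (-k) v) (L (-l) w)).re =
      (inner ℂ (L l v) (L k w)).re + ((k : ℝ) + l) * (inner ℂ v (L ((k : ℤ) - l) w)).re +
        if k = l then c / 12 * ((k : ℝ) ^ 3 - k) * (inner ℂ v w).re else 0 := by
  rw [hu.inner_map_neg, hL.apply_apply, inner_add_right, inner_add_right, inner_smul_right,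
    inner_smul_right, hu (-l), neg_neg]
  rw [Complex.add_re, Complex.add_re]
  congr 1
  · congr 1
    rw [show (((k : ℤ) : ℂ) - ((-(l : ℤ) : ℤ) : ℂ)) = (((k : ℝ) + l : ℝ) : ℂ) by push_cast; ring,
      Complex.re_ofReal_mul, sub_eq_add_neg]
  · by_cases h : k = l
    · subst h
      rw [if_pos (by simp), if_pos rfl, show ((c : ℂ) / 12 * (((k : ℤ) : ℂ) ^ 3 - ((k : ℤ) : ℂ))) =
        ((c / 12 * ((k : ℝ) ^ 3 - k) : ℝ) : ℂ) by push_cast; ring, Complex.re_ofReal_mul]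
    · rw [if_neg h, if_neg (by simpa using h), zero_mul, Complex.zero_re]

/-! ### Weighted and plain sums of squared norms -/

/-- The sum of `k ‖L k v‖ ^ 2` over `1 ≤ k ≤ K`. -/
noncomputable def weightedSum (L : ℤ → Module.End ℂ V) (K : ℕ) (v : V) : ℝ :=
  ∑ k ∈ Icc 1 K, (k : ℝ) * ‖L k v‖ ^ 2

/-- The sum of `‖L k v‖ ^ 2` over `1 ≤ k ≤ K`, the expectation of `∑ L (-k) L k` in `v`. -/
noncomputable def plainSum (L : ℤ → Module.End ℂ V) (K : ℕ) (v : V) : ℝ :=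
  ∑ k ∈ Icc 1 K, ‖L k v‖ ^ 2

/-- The bound for `weightedSum L K` at energy `e` which is stable under the induction on `e`. -/
noncomputable def weightedBound (c : ℝ) (K : ℕ) (e : ℝ) : ℝ :=
  K * (c / 3 * K ^ 2 * e + 14 / 3 * K * e ^ 2)

/-- The bound for `plainSum L K` at energy `e`. -/
noncomputable def plainBound (c : ℝ) (K : ℕ) (e : ℝ) : ℝ :=
  c / 2 * K ^ 2 * e + 28 / 3 * K * e ^ 2

theorem weightedSum_nonneg (K : ℕ) (v : V) : 0 ≤ weightedSum L K v :=
  sum_nonneg fun _ _ => by positivity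

theorem weightedBound_nonneg (hc : 0 ≤ c) (K : ℕ) {e : ℝ} (he : 0 ≤ e) :
    0 ≤ weightedBound c K e := by
  unfold weightedBound; positivity

/-- Abel summation turns the bounds on the weighted sums into one on the plain sum. -/
theorem plainSum_le (hc : 0 ≤ c) {e : ℝ} (he : 0 ≤ e) {v : V}
    (h : ∀ J, weightedSum L J v ≤ weightedBound c J e * ‖v‖ ^ 2) (K : ℕ) :
    plainSum L K v ≤ plainBound c K e * ‖v‖ ^ 2 := by
  -- The quotient `weightedSum L K v / K` is the boundary term of the summation by parts.
  have key : ∀ K : ℕ, plainSum L (K + 1) v ≤ weightedSum L (K + 1) v / (K + 1 : ℕ) +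
      (c / 3 * (K + 1 : ℕ) ^ 2 / 2 * e + 14 / 3 * (K + 1 : ℕ) * e ^ 2) * ‖v‖ ^ 2 := by
    intro K
    induction K with
    | zero =>
      simp only [plainSum, weightedSum, zero_add, Icc_self, sum_singleton, Nat.cast_one]
      have : 0 ≤ (c / 3 * 1 ^ 2 / 2 * e + 14 / 3 * 1 * e ^ 2) * ‖v‖ ^ 2 := by positivity
      linarith
    | succ K ih =>
      have hS := h (K + 1)
      unfold weightedBound at hS
      rw [show plainSum L (K + 1 + 1) v = plainSum L (K + 1) v + ‖L ((K + 1 + 1 : ℕ) : ℤ) v‖ ^ 2 by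
        unfold plainSum; rw [sum_Icc_succ_top (by omega)],
        show weightedSum L (K + 1 + 1) v =
          weightedSum L (K + 1) v + ((K + 1 + 1 : ℕ) : ℝ) * ‖L ((K + 1 + 1 : ℕ) : ℤ) v‖ ^ 2 by
        unfold weightedSum; rw [sum_Icc_succ_top (by omega)]]
      set S := weightedSum L (K + 1) v
      set P := plainSum L (K + 1) v
      set y := ‖L ((K + 1 + 1 : ℕ) : ℤ) v‖ ^ 2
      set n := ‖v‖ ^ 2 with hn
      have hn0 : 0 ≤ n := by positivity
      set x : ℝ := ((K + 1 : ℕ) : ℝ) with hx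
      have hx0 : 1 ≤ x := by rw [hx]; exact_mod_cast Nat.le_add_left 1 K
      rw [show ((K + 1 + 1 : ℕ) : ℝ) = x + 1 by rw [hx]; push_cast; ring]
      have e1 : (S + (x + 1) * y) / (x + 1) = S / (x + 1) + y := by field_simp
      have e2 : S / x - S / (x + 1) = S / (x * (x + 1)) := by field_simp; ring
      have e3 : S / (x * (x + 1)) ≤ (c / 3 * x * e + 14 / 3 * e ^ 2) * n := by
        rw [div_le_iff₀ (by positivity)]
        refine hS.trans ?_
        have : 0 ≤ (c / 3 * x * e + 14 / 3 * e ^ 2) * n * x := by positivity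
        nlinarith
      have e4 : 0 ≤ c * e * n := by positivity
      rw [e1]
      nlinarith
  rcases K with _ | K
  · simp [plainSum, plainBound]
  · refine (key K).trans ?_
    have hS := h (K + 1)
    have hK : (0 : ℝ) < ((K + 1 : ℕ) : ℝ) := by positivity
    have : weightedSum L (K + 1) v / (K + 1 : ℕ) ≤
        (c / 3 * (K + 1 : ℕ) ^ 2 * e + 14 / 3 * (K + 1 : ℕ) * e ^ 2) * ‖v‖ ^ 2 := by
      rw [div_le_iff₀ hK]
      unfold weightedBound at hS
      linarith
    unfold plainBound
    linarith

/-- The estimate of the term linear in `L` of the Gram matrix, with the contribution of each pair of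
entries `(k, l)`, `(l, k)` collected at the one with `l ≤ k`; here `x k` stands for `‖L k v‖` and
`y k l` for `‖L (k - l) (L l v)‖`. -/
noncomputable def linearTerm (K : ℕ) (e : ℝ) (x : ℕ → ℝ) (y : ℕ → ℕ → ℝ) (k l : ℕ) : ℝ :=
  (if l = k then 2 * (k : ℝ) ^ 3 * (e - k) * x k ^ 2 else 0) +
  (if l < k then K * (l : ℝ) ^ 2 / (2 * (e - l)) * y k l ^ 2 else 0) +
  (if l < k then 2 * (k : ℝ) ^ 2 * (k + l) ^ 2 * (e - l) / K * x k ^ 2 else 0)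

/-- The elementary inequality which closes the induction on the energy. The summands after the
first are, in order, the central term and the bounds on the diagonal and on the two kinds of
off-diagonal contributions to the linear term; `(k - 1) k (14 k - 1) / 6` is the sum of
`(k + l) ^ 2` over `1 ≤ l < k`. -/
theorem weightedBound_step (hc : 0 ≤ c) {k K : ℕ} (hk : 1 ≤ k) (hkK : k ≤ K) {e : ℝ}
    (he : (K : ℝ) ≤ e) :
    weightedBound c K (e - k) + c / 12 * (k * ((k : ℝ) ^ 3 - k)) + 2 * (k : ℝ) ^ 2 * (e - k) +
      K * k / 2 * (c / 2 * K ^ 2 + 28 / 3 * K * (e - k)) +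
      2 * k * (((k : ℝ) - 1) * k * (14 * k - 1) / 6) * e / K ≤ weightedBound c K e := by
  unfold weightedBound
  have hk1 : (1 : ℝ) ≤ k := by exact_mod_cast hk
  have hkK' : (k : ℝ) ≤ K := by exact_mod_cast hkK
  generalize (k : ℝ) = k at *
  generalize (K : ℝ) = K at *
  have hK : 0 < K := by linarith
  have he0 : 0 ≤ e := by linarith
  have h1 : c / 12 * (k * (k ^ 3 - k)) ≤ c / 12 * (K ^ 3 * k) := by
    have : k ^ 3 ≤ K ^ 3 := by gcongr
    refine mul_le_mul_of_nonneg_left ?_ (by positivity)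
    nlinarith
  have h2 : 2 * k * ((k - 1) * k * (14 * k - 1) / 6) * e / K ≤
      2 * k * e * ((k - 1) * (14 * k - 1) / 6) := by
    rw [div_le_iff₀ hK]
    have : 0 ≤ 2 * k * e * ((k - 1) * (14 * k - 1) / 6) := by
      have : 0 ≤ k - 1 := by linarith
      have : 0 ≤ 14 * k - 1 := by linarith
      positivity
    nlinarith
  have h3 : 2 * k ^ 2 * (e - k) ≤ 2 * k * e * k := by nlinarith [pow_pos (by linarith : 0 < k) 3]
  have h4 : (k - 1) * (14 * k - 1) / 6 + k ≤ 14 / 6 * K ^ 2 := by nlinarith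
  have h5 : 2 * k * e * ((k - 1) * (14 * k - 1) / 6 + k) ≤ 2 * k * e * (14 / 6 * K ^ 2) := by
    gcongr
  nlinarith

theorem sum_Ico_add_sq {k : ℕ} (hk : 1 ≤ k) :
    ∑ l ∈ Ico 1 k, ((k : ℝ) + l) ^ 2 = ((k : ℝ) - 1) * k * (14 * k - 1) / 6 := by
  have key : ∀ (n : ℕ) (a : ℝ), ∑ l ∈ Ico 1 (n + 1), (a + l) ^ 2 =
      n * a ^ 2 + a * n * (n + 1) + n * (n + 1) * (2 * n + 1) / 6 := by
    intro n a
    induction n with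
    | zero => simp
    | succ n ih => rw [sum_Ico_succ_top (by omega), ih]; push_cast; ring
  obtain ⟨k, rfl⟩ := Nat.exists_eq_add_of_le' hk
  rw [key]; push_cast; ring

/-! ### The norm of `∑ k L (-k) L k v` -/

theorem weightedSum_eq_re_inner (hu : IsUnitary L) (K : ℕ) (v : V) :
    weightedSum L K v =
      (inner ℂ v (∑ k ∈ Icc 1 K, (k : ℂ) • L (-(k : ℤ)) (L k v))).re := by
  rw [inner_sum, Complex.re_sum, weightedSum]
  refine sum_congr rfl fun k _ => ?_
  rw [inner_smul_right, hu, neg_neg, inner_self_eq_ofReal, ← Complex.ofReal_natCast,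
    Complex.re_ofReal_mul, Complex.ofReal_re]

theorem norm_sq_sum_eq (hL : IsRep c L) (hu : IsUnitary L) (K : ℕ) (v : V) :
    ‖∑ k ∈ Icc 1 K, (k : ℂ) • L (-(k : ℤ)) (L k v)‖ ^ 2 =
      (∑ k ∈ Icc 1 K, ∑ l ∈ Icc 1 K,
        (k : ℝ) * l * (inner ℂ (L l (L k v)) (L k (L l v))).re) +
      (∑ k ∈ Icc 1 K, ∑ l ∈ Icc 1 K,
        (k : ℝ) * l * (((k : ℝ) + l) * (inner ℂ (L k v) (L ((k : ℤ) - l) (L l v))).re)) +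
      ∑ k ∈ Icc 1 K, (k : ℝ) ^ 2 * (c / 12 * ((k : ℝ) ^ 3 - k)) * ‖L k v‖ ^ 2 := by
  have h (k l : ℕ) : (inner ℂ ((k : ℂ) • L (-(k : ℤ)) (L k v))
      ((l : ℂ) • L (-(l : ℤ)) (L l v))).re =
      (k : ℝ) * l * (inner ℂ (L l (L k v)) (L k (L l v))).re +
      (k : ℝ) * l * (((k : ℝ) + l) * (inner ℂ (L k v) (L ((k : ℤ) - l) (L l v))).re) +
      if k = l then (k : ℝ) ^ 2 * (c / 12 * ((k : ℝ) ^ 3 - k)) * ‖L k v‖ ^ 2 else 0 := by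
    rw [inner_smul_left, inner_smul_right, Complex.conj_natCast, ← Complex.ofReal_natCast k,
      ← Complex.ofReal_natCast l, Complex.re_ofReal_mul, Complex.re_ofReal_mul,
      re_inner_map_neg_map_neg hL hu]
    split_ifs with hkl
    · subst hkl
      rw [inner_self_eq_ofReal (L k v), Complex.ofReal_re]
      ring
    · ring
  rw [← inner_self_eq_norm_sq (𝕜 := ℂ), sum_inner, map_sum, ← sum_add_distrib, ← sum_add_distrib]
  refine sum_congr rfl fun k hk => ?_
  rw [inner_sum, map_sum]
  simp only [RCLike.re_to_complex]
  rw [sum_congr rfl fun l _ => h k l, sum_add_distrib, sum_add_distrib,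
    sum_ite_eq, if_pos hk]

theorem sum_exchange_le (K : ℕ) (v : V) :
    (∑ k ∈ Icc 1 K, ∑ l ∈ Icc 1 K,
        (k : ℝ) * l * (inner ℂ (L l (L k v)) (L k (L l v))).re) ≤
      ∑ k ∈ Icc 1 K, k * weightedSum L K (L k v) := by
  have h1 : ∀ k l : ℕ, (k : ℝ) * l * (inner ℂ (L l (L k v)) (L k (L l v))).re ≤
      (k * (l * ‖L l (L k v)‖ ^ 2) + l * (k * ‖L k (L l v)‖ ^ 2)) / 2 := by
    intro k l
    have h := (Complex.re_le_norm _).trans (norm_inner_le_norm (𝕜 := ℂ) (L l (L k v)) (L k (L l v)))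
    have h2 := two_mul_le_add_sq ‖L l (L k v)‖ ‖L k (L l v)‖
    have : (0 : ℝ) ≤ k * l := by positivity
    nlinarith
  refine (sum_le_sum fun k _ => sum_le_sum fun l _ => h1 k l).trans (le_of_eq ?_)
  simp_rw [← sum_div, sum_add_distrib]
  rw [sum_comm (f := fun k l : ℕ => (l : ℝ) * (k * ‖L k (L l v)‖ ^ 2))]
  simp_rw [weightedSum, mul_sum]
  ring

theorem linear_entry_symm (hu : IsUnitary L) (k l : ℕ) (v : V) :
    (inner ℂ (L k v) (L ((k : ℤ) - l) (L l v))).re =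
      (inner ℂ (L l v) (L ((l : ℤ) - k) (L k v))).re := by
  rw [hu, neg_sub, ← inner_conj_symm, Complex.conj_re]

/-- A pair of entries `(k, l)`, `(l, k)` with `l < k` is estimated by the arithmetic-geometric mean
inequality, giving the vector `L (k - l) (L l v)` the weight `K * l ^ 2 / (2 * (e - l))`. -/
theorem linear_entry_le (hL : IsRep c L) (hu : IsUnitary L) {K : ℕ} {e : ℝ} {v : V}
    (hv : L 0 v = (e : ℂ) • v) (he : (K : ℝ) ≤ e) {k l : ℕ}
    (hk : k ∈ Icc 1 K) (hl : l ∈ Icc 1 K) :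
    (k : ℝ) * l * (((k : ℝ) + l) * (inner ℂ (L k v) (L ((k : ℤ) - l) (L l v))).re) ≤
      (linearTerm K e (fun k => ‖L k v‖) (fun k l => ‖L ((k : ℤ) - l) (L l v)‖) k l +
       linearTerm K e (fun k => ‖L k v‖) (fun k l => ‖L ((k : ℤ) - l) (L l v)‖) l k) / 2 := by
  have key : ∀ k l : ℕ, k ∈ Icc 1 K → l < k →
      (k : ℝ) * l * (((k : ℝ) + l) * (inner ℂ (L k v) (L ((k : ℤ) - l) (L l v))).re) ≤
      (K * (l : ℝ) ^ 2 / (2 * (e - l)) * ‖L ((k : ℤ) - l) (L l v)‖ ^ 2 +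
        2 * (k : ℝ) ^ 2 * (k + l) ^ 2 * (e - l) / K * ‖L k v‖ ^ 2) / 2 := by
    intro k l hk hlk
    rw [mem_Icc] at hk
    have hKk : (k : ℝ) ≤ K := by exact_mod_cast hk.2
    have hlk' : (l : ℝ) < k := by exact_mod_cast hlk
    have hk0 : (1 : ℝ) ≤ k := by exact_mod_cast hk.1
    have hK0 : (0 : ℝ) < K := by linarith
    have hd : 0 < e - l := by linarith
    have h := (Complex.re_le_norm _).trans
      (norm_inner_le_norm (𝕜 := ℂ) (L k v) (L ((k : ℤ) - l) (L l v)))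
    have h3 : (k : ℝ) * l * (((k : ℝ) + l) * (inner ℂ (L k v) (L ((k : ℤ) - l) (L l v))).re) ≤
        (k : ℝ) * l * (((k : ℝ) + l) * (‖L k v‖ * ‖L ((k : ℤ) - l) (L l v)‖)) := by gcongr
    refine h3.trans ?_
    -- Twice the difference of the two sides is a positive multiple of a square.
    set x := ‖L k v‖
    set y := ‖L ((k : ℤ) - l) (L l v)‖
    have h4 : K * (l : ℝ) ^ 2 / (2 * (e - l)) * y ^ 2 +
        2 * (k : ℝ) ^ 2 * (k + l) ^ 2 * (e - l) / K * x ^ 2 -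
        2 * ((k : ℝ) * l * (((k : ℝ) + l) * (x * y))) =
        (K * l * y - 2 * k * (k + l) * (e - l) * x) ^ 2 / (2 * (e - l) * K) := by
      field_simp
      ring
    have h5 : 0 ≤ (K * l * y - 2 * k * (k + l) * (e - l) * x) ^ 2 / (2 * (e - l) * K) := by
      positivity
    linarith
  unfold linearTerm
  rcases lt_trichotomy l k with h | rfl | h
  · have := key k l hk h
    rw [if_neg h.ne, if_pos h, if_pos h, if_neg h.ne', if_neg h.not_gt, if_neg h.not_gt]
    linarith
  · rw [sub_self, hL.map_zero_apply hv l, inner_smul_right, Complex.re_ofReal_mul,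
      inner_self_eq_ofReal, Complex.ofReal_re]
    simp only [if_true, lt_irrefl, if_false]
    apply le_of_eq
    push_cast
    ring
  · have := key l k hl h
    rw [linear_entry_symm hu]
    rw [if_neg h.ne, if_pos h, if_pos h, if_neg h.ne', if_neg h.not_gt, if_neg h.not_gt]
    linarith

/-- The bound on the linear term. For fixed `l` the vectors `L (k - l) (L l v)` with `l < k ≤ K` are
among those entering `plainSum L K (L l v)`. -/
theorem sum_linear_le (hL : IsRep c L) (hu : IsUnitary L) (hc : 0 ≤ c) {K : ℕ} {e : ℝ} {v : V}
    (hv : L 0 v = (e : ℂ) • v) (he : (K : ℝ) ≤ e)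
    (ih : ∀ k ∈ Icc 1 K, plainSum L K (L k v) ≤ plainBound c K (e - k) * ‖L k v‖ ^ 2) :
    (∑ k ∈ Icc 1 K, ∑ l ∈ Icc 1 K,
        (k : ℝ) * l * (((k : ℝ) + l) * (inner ℂ (L k v) (L ((k : ℤ) - l) (L l v))).re)) ≤
      ∑ k ∈ Icc 1 K, k * (2 * (k : ℝ) ^ 2 * (e - k) +
        K * k / 2 * (c / 2 * K ^ 2 + 28 / 3 * K * (e - k)) +
        2 * k * (((k : ℝ) - 1) * k * (14 * k - 1) / 6) * e / K) * ‖L k v‖ ^ 2 := by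
  refine (sum_le_sum fun k hk => sum_le_sum fun l hl => linear_entry_le hL hu hv he hk hl).trans ?_
  set x : ℕ → ℝ := fun k => ‖L k v‖
  set y : ℕ → ℕ → ℝ := fun k l => ‖L ((k : ℤ) - l) (L l v)‖ with hy
  have h1 : ∑ k ∈ Icc 1 K, ∑ l ∈ Icc 1 K, (linearTerm K e x y k l + linearTerm K e x y l k) / 2 =
      ∑ k ∈ Icc 1 K, ∑ l ∈ Icc 1 K, linearTerm K e x y k l := by
    simp_rw [← sum_div, sum_add_distrib]
    rw [sum_comm (f := fun k l : ℕ => linearTerm K e x y l k)]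
    ring
  rw [h1]
  simp_rw [linearTerm, sum_add_distrib]
  rw [sum_comm (f := fun k l : ℕ =>
    if l < k then K * (l : ℝ) ^ 2 / (2 * (e - l)) * y k l ^ 2 else 0)]
  rw [← sum_add_distrib, ← sum_add_distrib]
  refine sum_le_sum fun k hk => ?_
  have hk' := mem_Icc.1 hk
  have hKk : (k : ℝ) ≤ K := by exact_mod_cast hk'.2
  have hk0 : (1 : ℝ) ≤ k := by exact_mod_cast hk'.1
  have hK0 : (0 : ℝ) < K := by linarith
  have hA : ∑ l ∈ Icc 1 K, (if l = k then 2 * (k : ℝ) ^ 3 * (e - k) * x k ^ 2 else 0) =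
      k * (2 * (k : ℝ) ^ 2 * (e - k)) * x k ^ 2 := by
    rw [sum_ite_eq', if_pos hk]; ring
  have hB : ∑ l ∈ Icc 1 K, (if k < l then K * (k : ℝ) ^ 2 / (2 * (e - k)) * y l k ^ 2 else 0) ≤
      k * (K * k / 2 * (c / 2 * K ^ 2 + 28 / 3 * K * (e - k))) * x k ^ 2 := by
    have hle : ∑ l ∈ Icc 1 K, (if k < l then y l k ^ 2 else 0) ≤ plainSum L K (L k v) := by
      rw [← sum_filter, plainSum]
      have hbij : ∑ l ∈ Icc 1 K with k < l, y l k ^ 2 =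
          ∑ m ∈ Icc 1 (K - k), ‖L m (L k v)‖ ^ 2 := by
        refine sum_nbij' (fun l => l - k) (fun m => m + k) ?_ ?_ ?_ ?_ ?_
        · intro l hl; simp only [mem_filter, mem_Icc] at hl ⊢; omega
        · intro m hm; simp only [mem_filter, mem_Icc] at hm ⊢; omega
        · intro l hl; simp only [mem_filter, mem_Icc] at hl; omega
        · intro m _; omega
        · intro l hl
          simp only [mem_filter, mem_Icc] at hl
          simp only [hy]
          rw [Nat.cast_sub hl.2.le]
      rw [hbij]
      exact sum_le_sum_of_subset_of_nonneg (Icc_subset_Icc_right (by omega))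
        fun _ _ _ => by positivity
    have : ∑ l ∈ Icc 1 K, (if k < l then K * (k : ℝ) ^ 2 / (2 * (e - k)) * y l k ^ 2 else 0) =
        K * (k : ℝ) ^ 2 / (2 * (e - k)) * ∑ l ∈ Icc 1 K, (if k < l then y l k ^ 2 else 0) := by
      rw [mul_sum]; simp_rw [mul_ite, mul_zero]
    rw [this]
    have hd : 0 ≤ e - k := by linarith
    refine (mul_le_mul_of_nonneg_left (hle.trans (ih k hk)) (by positivity)).trans ?_
    unfold plainBound
    rcases hd.eq_or_lt with hd | hd
    -- For `k = e` the division by zero makes the left-hand side vanish; it is an empty sum anyway.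
    · rw [← hd]
      simp only [mul_zero, div_zero, zero_mul]
      positivity
    · apply le_of_eq
      change _ * (_ * x k ^ 2) = _
      field_simp
  have hC : ∑ l ∈ Icc 1 K,
      (if l < k then 2 * (k : ℝ) ^ 2 * (k + l) ^ 2 * (e - l) / K * x k ^ 2 else 0) ≤
      k * (2 * k * (((k : ℝ) - 1) * k * (14 * k - 1) / 6) * e / K) * x k ^ 2 := by
    rw [← sum_Ico_add_sq hk'.1, ← sum_filter]
    have : (Icc 1 K).filter (fun l => l < k) = Ico 1 k := by
      ext l; simp only [mem_filter, mem_Icc, mem_Ico]; omega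
    rw [this]
    simp_rw [mul_sum, sum_mul, sum_div, mul_sum, sum_mul]
    refine sum_le_sum fun l _ => ?_
    rw [show (k : ℝ) * (2 * k * ((k : ℝ) + l) ^ 2 * e / K) * x k ^ 2 =
      2 * (k : ℝ) ^ 2 * (k + l) ^ 2 * e / K * x k ^ 2 by ring]
    gcongr
    have : (0 : ℝ) ≤ l := by positivity
    linarith
  rw [hA]
  linarith

/-! ### Induction on the energy -/

/-- The part of the induction on the energy for `K ≤ e`. With `X = ∑ k L (-k) L k v`, the weighted sum
`S = ⟨v, X⟩` satisfies `S ^ 2 ≤ ‖v‖ ^ 2 * ‖X‖ ^ 2` and `‖X‖ ^ 2 ≤ weightedBound c K e * S`. -/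
theorem weightedSum_le_of_lower (hL : IsRep c L) (hu : IsUnitary L) (hc : 0 ≤ c) {K : ℕ} {e : ℝ}
    {v : V} (hv : L 0 v = (e : ℂ) • v) (he : (K : ℝ) ≤ e)
    (ih : ∀ k ∈ Icc 1 K, ∀ J,
      weightedSum L J (L k v) ≤ weightedBound c J (e - k) * ‖L k v‖ ^ 2) :
    weightedSum L K v ≤ weightedBound c K e * ‖v‖ ^ 2 := by
  have he0 : 0 ≤ e := le_trans (by positivity) he
  have hX : ‖∑ k ∈ Icc 1 K, (k : ℂ) • L (-(k : ℤ)) (L k v)‖ ^ 2 ≤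
      weightedBound c K e * weightedSum L K v := by
    rw [norm_sq_sum_eq hL hu]
    have h1 := sum_exchange_le (L := L) K v
    have h2 := sum_linear_le hL hu hc hv he fun k hk =>
      plainSum_le hc (by
        have : (k : ℝ) ≤ K := by exact_mod_cast (mem_Icc.1 hk).2
        linarith) (ih k hk) K
    refine (add_le_add_left (add_le_add h1 h2) _).trans ?_
    rw [weightedSum, mul_sum, ← sum_add_distrib, ← sum_add_distrib]
    refine sum_le_sum fun k hk => ?_
    have h3 := ih k hk K
    have h4 := weightedBound_step hc (mem_Icc.1 hk).1 (mem_Icc.1 hk).2 he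
    have h5 : (0 : ℝ) ≤ k * ‖L k v‖ ^ 2 := by positivity
    have h6 := mul_le_mul_of_nonneg_right h4 h5
    have h7 := mul_le_mul_of_nonneg_left h3 (Nat.cast_nonneg (α := ℝ) k)
    linarith
  have hG := weightedBound_nonneg hc K he0
  have hS := weightedSum_nonneg (L := L) K v
  have hin : weightedSum L K v ≤ ‖v‖ * ‖∑ k ∈ Icc 1 K, (k : ℂ) • L (-(k : ℤ)) (L k v)‖ := by
    rw [weightedSum_eq_re_inner hu]
    exact (Complex.re_le_norm _).trans (norm_inner_le_norm _ _)
  rcases hS.eq_or_lt with h0 | h0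
  · rw [← h0]; positivity
  · have h1 : weightedSum L K v * weightedSum L K v ≤
        weightedBound c K e * ‖v‖ ^ 2 * weightedSum L K v := by
      calc _ = weightedSum L K v ^ 2 := by ring
        _ ≤ (‖v‖ * ‖∑ k ∈ Icc 1 K, (k : ℂ) • L (-(k : ℤ)) (L k v)‖) ^ 2 := by gcongr
        _ = ‖v‖ ^ 2 * ‖∑ k ∈ Icc 1 K, (k : ℂ) • L (-(k : ℤ)) (L k v)‖ ^ 2 := by ring
        _ ≤ ‖v‖ ^ 2 * (weightedBound c K e * weightedSum L K v) := by gcongr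
        _ = _ := by ring
    exact le_of_mul_le_mul_right h1 h0

/-- All real eigenvalues of `L 0` are nonnegative. -/
def HasNonnegEnergy (L : ℤ → Module.End ℂ V) : Prop :=
  ∀ (e : ℝ) (v : V), e < 0 → L 0 v = (e : ℂ) • v → v = 0

theorem HasNonnegEnergy.map_eq_zero (hpos : HasNonnegEnergy L) (hL : IsRep c L) {e : ℝ} {v : V}
    (hv : L 0 v = (e : ℂ) • v) {k : ℤ} (hk : e < k) : L k v = 0 :=
  hpos _ _ (by linarith) (hL.map_zero_apply hv k)

theorem HasNonnegEnergy.sum_eq_sum_floor (hpos : HasNonnegEnergy L) (hL : IsRep c L) {e : ℝ} {v : V}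
    (hv : L 0 v = (e : ℂ) • v) {K : ℕ} (hK : ⌊e⌋₊ ≤ K) (w : ℕ → ℝ) :
    ∑ k ∈ Icc 1 K, w k * ‖L k v‖ ^ 2 = ∑ k ∈ Icc 1 ⌊e⌋₊, w k * ‖L k v‖ ^ 2 := by
  refine (sum_subset (Icc_subset_Icc_right hK) fun k hk hk' => ?_).symm
  rw [mem_Icc] at hk hk'
  have : e < ((k : ℤ) : ℝ) := by
    rw [Int.cast_natCast]
    exact Nat.lt_of_floor_lt (by omega)
  rw [hpos.map_eq_zero hL hv this]
  simp

theorem weightedSum_le (hL : IsRep c L) (hu : IsUnitary L) (hc : 0 ≤ c)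
    (hpos : HasNonnegEnergy L) {e : ℝ} {v : V} (hv : L 0 v = (e : ℂ) • v) (K : ℕ) :
    weightedSum L K v ≤ weightedBound c K e * ‖v‖ ^ 2 := by
  obtain ⟨n, hn⟩ := exists_nat_gt e
  induction n generalizing e v K with
  | zero =>
    rw [hpos e v (by simpa using hn) hv]
    simp [weightedSum]
  | succ n ihn =>
    rcases lt_or_ge e 0 with he | he
    · rw [hpos e v he hv]
      simp [weightedSum]
    -- The modes with `k > e` annihilate `v`, so the cut-off may be lowered to `⌊e⌋₊`.
    have main : ∀ K : ℕ, (K : ℝ) ≤ e → weightedSum L K v ≤ weightedBound c K e * ‖v‖ ^ 2 := by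
      intro K hK
      refine weightedSum_le_of_lower hL hu hc hv hK fun k hk J => ?_
      have h1 : (1 : ℝ) ≤ k := by exact_mod_cast (mem_Icc.1 hk).1
      push_cast at hn
      exact ihn (by simpa using hL.map_zero_apply hv k) J (by linarith)
    rcases le_or_gt K ⌊e⌋₊ with hK | hK
    · exact main K ((Nat.le_floor_iff he).1 hK)
    · rw [weightedSum, hpos.sum_eq_sum_floor hL hv hK.le]
      refine (main _ (Nat.floor_le he)).trans ?_
      unfold weightedBound
      have : (⌊e⌋₊ : ℝ) ≤ K := by exact_mod_cast hK.le
      gcongr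

/-- At energy `e` the expectation of `∑ L (-k) L k` is `O(e ^ 3)`, with a constant affine in `c`. -/
theorem plainSum_le_cube (hL : IsRep c L) (hu : IsUnitary L) (hc : 0 ≤ c)
    (hpos : HasNonnegEnergy L) {e : ℝ} (he : 0 ≤ e) {v : V} (hv : L 0 v = (e : ℂ) • v) (K : ℕ) :
    plainSum L K v ≤ (c / 2 + 28 / 3) * e ^ 3 * ‖v‖ ^ 2 := by
  have main : ∀ K : ℕ, (K : ℝ) ≤ e → plainSum L K v ≤ (c / 2 + 28 / 3) * e ^ 3 * ‖v‖ ^ 2 := by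
    intro K hK
    refine (plainSum_le hc he (fun J => weightedSum_le hL hu hc hpos hv J) K).trans ?_
    gcongr
    calc plainBound c K e ≤ c / 2 * e ^ 2 * e + 28 / 3 * e * e ^ 2 := by
          unfold plainBound; gcongr
      _ = _ := by ring
  rcases le_or_gt K ⌊e⌋₊ with hK | hK
  · exact main K ((Nat.le_floor_iff he).1 hK)
  · have h := hpos.sum_eq_sum_floor hL hv hK.le fun _ => 1
    simp only [one_mul] at h
    rw [plainSum, h]
    exact main _ (Nat.floor_le he)

/-! ### Energy decomposition -/

/-- The vector `L (-(n₁ + 1)) ⋯ L (-(nᵣ + 1)) Ω` attached to the list `[n₁, …, nᵣ]`. -/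
def creationWord (L : ℤ → Module.End ℂ V) (Ω : V) : List ℕ → V
  | [] => Ω
  | n :: l => L (-((n : ℤ) + 1)) (creationWord L Ω l)

/-- The span of the vectors `L (-n₁) ⋯ L (-nᵣ) Ω` with all `nᵢ ≥ 1`. -/
def creationSpan (L : ℤ → Module.End ℂ V) (Ω : V) : Submodule ℂ V :=
  Submodule.span ℂ (Set.range (creationWord L Ω))

theorem creationWord_mem_creationSpan (Ω : V) (l : List ℕ) :
    creationWord L Ω l ∈ creationSpan L Ω :=
  Submodule.subset_span ⟨l, rfl⟩

theorem map_neg_mem_creationSpan {Ω v : V} (hv : v ∈ creationSpan L Ω) (n : ℕ) :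
    L (-((n : ℤ) + 1)) v ∈ creationSpan L Ω := by
  have : creationSpan L Ω ≤ (creationSpan L Ω).comap (L (-((n : ℤ) + 1))) := by
    refine Submodule.span_le.2 ?_
    rintro _ ⟨l, rfl⟩
    exact creationWord_mem_creationSpan Ω (n :: l)
  exact this hv

theorem creationSpan_isInvariant (hL : IsRep c L) {Ω : V} {h : ℝ} (h0 : L 0 Ω = (h : ℂ) • Ω)
    (hann : ∀ n : ℤ, 0 < n → L n Ω = 0) : IsInvariant L (creationSpan L Ω) := by
  have hΩ : Ω ∈ creationSpan L Ω := creationWord_mem_creationSpan Ω []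
  -- Commuting `L m` past the first factor of a word leaves operators acting on a shorter word.
  have key : ∀ (l : List ℕ) (m : ℤ),
      L m (creationWord L Ω l) ∈ creationSpan L Ω := by
    intro l
    induction l with
    | nil =>
      intro m
      rcases lt_trichotomy m 0 with hm | rfl | hm
      · have := map_neg_mem_creationSpan hΩ (-m - 1).toNat
        rwa [show -(((-m - 1).toNat : ℤ) + 1) = m by omega] at this
      · rw [creationWord, h0]
        exact Submodule.smul_mem _ _ hΩ
      · rw [creationWord, hann m hm]
        exact Submodule.zero_mem _
    | cons n l ih =>
      intro m
      rw [creationWord, hL.apply_apply]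
      exact Submodule.add_mem _ (Submodule.add_mem _ (map_neg_mem_creationSpan (ih m) n)
        (Submodule.smul_mem _ _ (ih _))) (Submodule.smul_mem _ _ (creationWord_mem_creationSpan Ω l))
  intro m v hv
  have : creationSpan L Ω ≤ (creationSpan L Ω).comap (L m) := by
    refine Submodule.span_le.2 ?_
    rintro _ ⟨l, rfl⟩
    exact key l m
  exact this hv

theorem creationSpan_le (hL : IsRep c L) {Ω : V} {h : ℝ} (hh : 0 ≤ h)
    (h0 : L 0 Ω = (h : ℂ) • Ω) :
    creationSpan L Ω ≤ ⨆ e : {e : ℝ // 0 ≤ e}, (L 0).eigenspace ((e : ℝ) : ℂ) := by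
  refine Submodule.span_le.2 ?_
  rintro _ ⟨l, rfl⟩
  have : ∃ e : ℝ, 0 ≤ e ∧ L 0 (creationWord L Ω l) =
      (e : ℂ) • creationWord L Ω l := by
    induction l with
    | nil => exact ⟨h, hh, h0⟩
    | cons n l ih =>
      obtain ⟨e, he, hev⟩ := ih
      refine ⟨_, ?_, hL.map_zero_apply hev _⟩
      push_cast
      linarith [Nat.cast_nonneg (α := ℝ) n]
  obtain ⟨e, he, hev⟩ := this
  exact Submodule.mem_iSup_of_mem (⟨e, he⟩ : {e : ℝ // 0 ≤ e}) (Module.End.mem_eigenspace_iff.2 hev)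

/-- By cyclicity, a lowest weight representation is contained in the span of the words in the
lowest weight vector. -/
theorem IsLowestWeight.le_iSup_eigenspace (hL : IsRep c L) {W : Submodule ℂ V} {h : ℝ}
    (hh : 0 ≤ h) (hW : IsLowestWeight L W h) :
    W ≤ ⨆ e : {e : ℝ // 0 ≤ e}, (L 0).eigenspace ((e : ℝ) : ℂ) := by
  obtain ⟨Ω, -, -, h0, hann, hcyc⟩ := hW.exists_cyclic
  exact (hcyc _ (creationSpan_isInvariant hL h0 hann) (creationWord_mem_creationSpan Ω [])).trans
    (creationSpan_le hL hh h0)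

theorem IsUnitary.inner_eq_zero (hu : IsUnitary L) {e e' : ℝ} (hne : e ≠ e') {v w : V}
    (hv : L 0 v = (e : ℂ) • v) (hw : L 0 w = (e' : ℂ) • w) : inner ℂ v w = 0 := by
  have h := hu 0 w v
  rw [neg_zero, hw, hv, inner_smul_right, inner_smul_left, Complex.conj_ofReal, ← sub_eq_zero,
    ← sub_mul, mul_eq_zero, sub_eq_zero, Complex.ofReal_inj] at h
  exact h.resolve_left hne.symm

/-- An eigenvector with negative eigenvalue is orthogonal to a spanning set. -/
theorem hasNonnegEnergy_of_iSup_eq_top (hu : IsUnitary L)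
    (htop : ⨆ e : {e : ℝ // 0 ≤ e}, (L 0).eigenspace ((e : ℝ) : ℂ) = ⊤) : HasNonnegEnergy L := by
  intro e v he hv
  have : (⊤ : Submodule ℂ V) ≤ LinearMap.ker (innerₛₗ ℂ v) := by
    rw [← htop]
    refine iSup_le fun e' w hw => ?_
    exact hu.inner_eq_zero (he.trans_le e'.2).ne hv (Module.End.mem_eigenspace_iff.1 hw)
  exact inner_self_eq_zero.1 (this (Submodule.mem_top (x := v)))

theorem exists_forall_map_eq_zero (hL : IsRep c L) (hpos : HasNonnegEnergy L)
    (htop : ⨆ e : {e : ℝ // 0 ≤ e}, (L 0).eigenspace ((e : ℝ) : ℂ) = ⊤) (v : V) :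
    ∃ K : ℕ, ∀ k : ℤ, (K : ℤ) < k → L k v = 0 := by
  have hv : v ∈ ⨆ e : {e : ℝ // 0 ≤ e}, (L 0).eigenspace ((e : ℝ) : ℂ) :=
    htop ▸ Submodule.mem_top
  induction hv using Submodule.iSup_induction' with
  | mem e w hw =>
    obtain ⟨K, hK⟩ := exists_nat_gt (e : ℝ)
    refine ⟨K, fun k hk => hpos.map_eq_zero hL (Module.End.mem_eigenspace_iff.1 hw) (hK.trans ?_)⟩
    exact_mod_cast hk
  | zero => exact ⟨0, fun k _ => map_zero _⟩
  | add x y _ _ hx hy =>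
    obtain ⟨K, hK⟩ := hx
    obtain ⟨J, hJ⟩ := hy
    refine ⟨max K J, fun k hk => ?_⟩
    rw [map_add, hK k (by omega), hJ k (by omega), add_zero]

/-- A quadratic form given by an operator commuting with `L 0` need only be tested on
eigenvectors of `L 0`. -/
theorem inner_nonneg_of_eigenvectors (hu : IsUnitary L)
    (htop : ⨆ e : {e : ℝ // 0 ≤ e}, (L 0).eigenspace ((e : ℝ) : ℂ) = ⊤) {D : Module.End ℂ V}
    (hD : L 0 * D = D * L 0)
    (h : ∀ (e : ℝ) (v : V), 0 ≤ e → L 0 v = (e : ℂ) • v → 0 ≤ inner ℂ v (D v)) (v : V) :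
    0 ≤ inner ℂ v (D v) := by
  have hv : v ∈ ⨆ e : {e : ℝ // 0 ≤ e}, (L 0).eigenspace ((e : ℝ) : ℂ) :=
    htop ▸ Submodule.mem_top
  obtain ⟨f, hf, rfl⟩ := (Submodule.mem_iSup_iff_exists_finsupp _ _).1 hv
  have hf' : ∀ e, L 0 (f e) = ((e : ℝ) : ℂ) • f e := fun e => Module.End.mem_eigenspace_iff.1 (hf e)
  rw [Finsupp.sum, map_sum, sum_inner]
  refine sum_nonneg fun e he => ?_
  rw [inner_sum, sum_eq_single_of_mem e he]
  · exact h e _ e.2 (hf' e)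
  · intro e' _ hne
    refine hu.inner_eq_zero (fun h => hne (Subtype.ext h.symm)) (hf' e) ?_
    have := congrArg (fun T : Module.End ℂ V => T (f e')) hD
    simp only [Module.End.mul_apply] at this
    rw [this, hf', map_smul]

/-! ### The normal-ordered square -/

theorem sum_Icc_neg_eq {M : Type*} [AddCommGroup M] (f : ℤ → M) (K : ℕ) :
    ∑ k ∈ Icc (-(K : ℤ)) K, f k = f 0 + ∑ k ∈ Icc 1 K, (f (k : ℤ) + f (-(k : ℤ))) := by
  induction K with
  | zero => simp
  | succ K ih =>
    rw [sum_Icc_succ_top (by omega), Nat.cast_succ, sum_Icc_succ_eq_add_endpoints, ih]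
    abel

/-- The zero mode of the normal-ordered square, cut off to the modes `|k| ≤ K`. The summand
`2 • L 0` comes from the ordering `L 1 * L (-1)` of the term `k = -1`. -/
noncomputable def truncatedSquare (L : ℤ → Module.End ℂ V) (K : ℕ) : Module.End ℂ V :=
  L 0 * L 0 + (2 : ℂ) • L 0 + (2 : ℂ) • ∑ k ∈ Icc 1 K, L (-(k : ℤ)) * L k

theorem support_normalTerm_subset {v : V} {K : ℕ} (hK : ∀ k : ℤ, (K : ℤ) < k → L k v = 0)
    (hK1 : 1 ≤ K) : {k : ℤ | normalTerm L 0 k v ≠ 0} ⊆ Icc (-(K : ℤ)) K := by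
  intro k hk
  rw [Set.mem_ofPred_eq] at hk
  rw [coe_Icc, Set.mem_Icc]
  by_contra hcon
  refine hk ?_
  unfold normalTerm
  split_ifs with h
  · rw [Module.End.mul_apply, hK k (by omega), map_zero]
  · rw [Module.End.mul_apply, hK (0 - k) (by omega), map_zero]

theorem normalSquare_eq_sum {v : V} {K : ℕ} (hK : ∀ k : ℤ, (K : ℤ) < k → L k v = 0)
    (hK1 : 1 ≤ K) : normalSquare L 0 v = ∑ k ∈ Icc (-(K : ℤ)) K, normalTerm L 0 k v :=
  finsum_eq_sum_of_support_subset _ (support_normalTerm_subset hK hK1)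

theorem normalSquare_eq_truncatedSquare (hL : IsRep c L) {v : V} {K : ℕ}
    (hK : ∀ k : ℤ, (K : ℤ) < k → L k v = 0) (hK1 : 1 ≤ K) :
    normalSquare L 0 v = truncatedSquare L K v := by
  rw [normalSquare_eq_sum hK hK1, sum_Icc_neg_eq]
  have h : ∀ k ∈ Icc 1 K, normalTerm L 0 (k : ℤ) v + normalTerm L 0 (-(k : ℤ)) v =
      (if k = 1 then (2 : ℂ) • L 0 v else 0) + (2 : ℂ) • L (-(k : ℤ)) (L k v) := by
    intro k hk
    rw [mem_Icc] at hk
    unfold normalTerm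
    rw [if_pos (by omega), Module.End.mul_apply, zero_sub]
    rcases eq_or_ne k 1 with rfl | hk1
    · rw [if_pos (by norm_num), if_pos rfl, Module.End.mul_apply, zero_sub, neg_neg,
        hL.apply_apply ((1 : ℕ) : ℤ)]
      norm_num
      module
    · rw [if_neg (by omega), if_neg hk1, Module.End.mul_apply, zero_sub, neg_neg, zero_add,
        two_smul]
  rw [sum_congr rfl h, sum_add_distrib, sum_ite_eq', if_pos (mem_Icc.2 ⟨le_rfl, hK1⟩)]
  simp [truncatedSquare, normalTerm, smul_sum, add_assoc]

/-- Each normally ordered term is of the form `T† T`. -/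
theorem inner_normalTerm_nonneg (hu : IsUnitary L) (k : ℤ) (v : V) :
    0 ≤ inner ℂ v (normalTerm L 0 k v) := by
  have h (w : V) : 0 ≤ inner ℂ w w := by
    rw [inner_self_eq_ofReal]
    exact Complex.zero_le_real.2 (sq_nonneg _)
  unfold normalTerm
  split_ifs
  · rw [Module.End.mul_apply, hu, zero_sub, neg_neg]
    exact h _
  · rw [Module.End.mul_apply, hu, zero_sub]
    exact h _

theorem truncatedSquare_comm (hL : IsRep c L) (K : ℕ) :
    L 0 * truncatedSquare L K = truncatedSquare L K * L 0 := by
  have h : ∀ k : ℕ, Commute (L 0) (L (-(k : ℤ)) * L k) := by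
    intro k
    ext v
    simp only [Module.End.mul_apply]
    rw [hL.apply_apply 0, hL.apply_apply 0 k v]
    simp
  exact (((Commute.refl _).mul_right (Commute.refl _)).add_right
    ((Commute.refl _).smul_right _)).add_right
      ((Commute.sum_right _ _ _ fun k _ => h k).smul_right _)

theorem inner_truncatedSquare (hu : IsUnitary L) (K : ℕ) {e : ℝ} {v : V}
    (hv : L 0 v = (e : ℂ) • v) :
    inner ℂ v (truncatedSquare L K v) =
      (((e ^ 2 + 2 * e) * ‖v‖ ^ 2 + 2 * plainSum L K v : ℝ) : ℂ) := by
  have h : ∀ k : ℕ, inner ℂ v (L (-(k : ℤ)) (L k v)) = ((‖L k v‖ ^ 2 : ℝ) : ℂ) := by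
    intro k
    rw [hu, neg_neg, inner_self_eq_ofReal]
  simp only [truncatedSquare, LinearMap.add_apply, LinearMap.smul_apply, Module.End.mul_apply,
    LinearMap.sum_apply, inner_add_right, inner_smul_right, inner_sum, h, hv, map_smul,
    inner_self_eq_ofReal, plainSum]
  push_cast
  ring

theorem inner_truncatedSquare_le (hL : IsRep c L) (hu : IsUnitary L) (hc : 1 ≤ c)
    (htop : ⨆ e : {e : ℝ // 0 ≤ e}, (L 0).eigenspace ((e : ℝ) : ℂ) = ⊤) (K : ℕ) (v : V) :
    inner ℂ v (truncatedSquare L K v) ≤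
      inner ℂ v (((11 * ((c : ℂ) + 1)) • (1 + L 0 ^ 3 : Module.End ℂ V)) v) := by
  have hpos := hasNonnegEnergy_of_iSup_eq_top hu htop
  rw [← sub_nonneg, ← inner_sub_right, ← LinearMap.sub_apply]
  refine inner_nonneg_of_eigenvectors hu htop ?_ ?_ v
  · refine Commute.sub_right (Commute.smul_right ?_ _) (truncatedSquare_comm hL K)
    exact (Commute.one_right _).add_right ((Commute.refl _).pow_right 3)
  · intro e w he hw
    have h3 : (L 0 ^ 3) w = ((e ^ 3 : ℝ) : ℂ) • w := by
      simp only [pow_succ, pow_zero, one_mul, Module.End.mul_apply, hw, map_smul, smul_smul]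
      push_cast
      ring_nf
    rw [LinearMap.sub_apply, inner_sub_right, inner_truncatedSquare hu K hw, LinearMap.smul_apply,
      LinearMap.add_apply, Module.End.one_apply, h3, inner_smul_right, inner_add_right,
      inner_smul_right, inner_self_eq_ofReal]
    have hb := plainSum_le_cube hL hu (by linarith) hpos he hw K
    have hreal : 0 ≤ 11 * (c + 1) * (‖w‖ ^ 2 + e ^ 3 * ‖w‖ ^ 2) -
        ((e ^ 2 + 2 * e) * ‖w‖ ^ 2 + 2 * plainSum L K w) := by
      have hpoly : (e ^ 2 + 2 * e) + 2 * ((c / 2 + 28 / 3) * e ^ 3) ≤ 11 * (c + 1) * (1 + e ^ 3) := by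
        have h0 : 0 ≤ e ^ 3 := by positivity
        have h1 : 0 ≤ (c - 1) * (11 + 10 * e ^ 3) := mul_nonneg (by linarith) (by positivity)
        have h2 : e ^ 2 + 2 * e ≤ 22 + e ^ 3 := by
          nlinarith [mul_nonneg he (sq_nonneg (e - 1)), sq_nonneg (e - 1)]
        nlinarith
      have := mul_le_mul_of_nonneg_right hpoly (sq_nonneg ‖w‖)
      linarith
    exact_mod_cast hreal

end Virasoro

theorem corollary4p4 {V : Type*} [NormedAddCommGroup V] [InnerProductSpace ℂ V]
    (c : ℝ) (hc : 1 ≤ c) (L : ℤ → Module.End ℂ V)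
    (hL : Virasoro.IsRep c L) (hunitary : Virasoro.IsUnitary L)
    {ι : Type*} [DecidableEq ι] (W : ι → Submodule ℂ V) (hsum : DirectSum.IsInternal W)
    (h : ι → ℝ) (hh : ∀ i, 0 ≤ h i)
    (hirr : ∀ i, Virasoro.IsIrreducible L (W i))
    (hlow : ∀ i, Virasoro.IsLowestWeight L (W i) (h i)) (Ψ : V) :
    {k : ℤ | Virasoro.normalTerm L 0 k Ψ ≠ 0}.Finite ∧
    0 ≤ inner ℂ Ψ (Virasoro.normalSquare L 0 Ψ) ∧
    inner ℂ Ψ (Virasoro.normalSquare L 0 Ψ) ≤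
      inner ℂ Ψ (((11 * ((c : ℂ) + 1)) • (1 + L 0 ^ 3 : Module.End ℂ V)) Ψ) := by
  have htop : ⨆ e : {e : ℝ // 0 ≤ e}, (L 0).eigenspace ((e : ℝ) : ℂ) = ⊤ := by
    rw [eq_top_iff, ← hsum.submodule_iSup_eq_top]
    exact iSup_le fun i => (hlow i).le_iSup_eigenspace hL (hh i)
  obtain ⟨J, hJ⟩ := Virasoro.exists_forall_map_eq_zero hL
    (Virasoro.hasNonnegEnergy_of_iSup_eq_top hunitary htop) htop Ψ
  have hK : ∀ k : ℤ, ((J + 1 : ℕ) : ℤ) < k → L k Ψ = 0 := fun k hk => hJ k (by omega)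
  have hK1 : 1 ≤ J + 1 := Nat.le_add_left 1 J
  refine ⟨(Finset.finite_toSet _).subset (Virasoro.support_normalTerm_subset hK hK1), ?_, ?_⟩
  · rw [Virasoro.normalSquare_eq_sum hK hK1, inner_sum]
    exact Finset.sum_nonneg fun k _ => Virasoro.inner_normalTerm_nonneg hunitary k Ψ
  · rw [Virasoro.normalSquare_eq_truncatedSquare hL hK hK1]
    exact Virasoro.inner_truncatedSquare_le hL hunitary hc htop _ Ψ
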